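/- A rack is a set $Q$ with two binary operations $*$ and $\backslash$ such that $x*(x\backslash y)=y=x\backslash(x*y)$ and $x*(y*z)=(x*y)*(x*z)$ for all $x,y,z\in Q$. Congruences of $Q$ are the equivalence relations on $Q$ that are invariant under both operations; $0_Q$ denotes the smallest congruence and $1_Q$ the largest one. Let $\beta\le\alpha$ be congruences of $Q$. The congruence $\alpha$ is *strongly abelian over* $\beta$ if for every term $t(x,y_1,\dots,y_m)$ in $*,\backslash$, all $u\,\alpha\,v$ and all $a_i,b_i,c_i\in Q$ with $a_i\,\alpha\,b_i\,\alpha\,c_i$ $(1\le i\le m)$, $$t(u,a_1,\dots,a_m)\;\beta\;t(v,b_1,\dots,b_m)\quad\text{implies}\quad t(u,c_1,\dots,c_m)\;\beta\;t(v,c_1,\dots,c_m).$$ The congruence $\alpha$ is *central over* $\beta$ (that is, $\alpha/\beta$ is a central congruence of $Q/\beta$) if for every term $t(x,y_1,\dots,y_m)$, all $u\,\alpha\,v$ and all $a_i,b_i\in Q$ $(1\le i\le m)$, $$t(u,a_1,\dots,a_m)\;\beta\;t(u,b_1,\dots,b_m)\quad\text{implies}\quad t(v,a_1,\dots,a_m)\;\beta\;t(v,b_1,\dots,b_m).$$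 The rack $Q$ is *strongly solvable of length at most $n$* (respectively *nilpotent of length at most $n$*) if there are congruences $0_Q=\alpha_0\le\alpha_1\le\dots\le\alpha_n=1_Q$ such that $\alpha_{i+1}$ is strongly abelian over (respectively central over) $\alpha_i$ for every $0\le i<n$. **Theorem.** Let $n\ge 0$. Every rack which is strongly solvable of length at most $n$ is nilpotent of length at most $n$. -/

import Mathlib

open scoped Quandles

namespace RackAlgebra

universe u v

/-- Terms over the signature `(*, \)` of racks with variables in `ι`. -/
inductive Term (ι : Type v) : Type v
  | var (i : ι) : Term ι
  | act (s t : Term ι) : Term ι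
  | invAct (s t : Term ι) : Term ι

/-- The value of a term in a rack `Q`: the operation `x * y` is `x ◃ y`, and the left
division `x \ y` is `x ◃⁻¹ y`. -/
def Term.eval {ι : Type v} {Q : Type u} [Rack Q] (f : ι → Q) : Term ι → Q
  | .var i => f i
  | .act s t => s.eval f ◃ t.eval f
  | .invAct s t => s.eval f ◃⁻¹ t.eval f

/-- The value `t(x, y₁, …, yₙ)` of a term in `n + 1` variables. -/
def Term.app {n : ℕ} {Q : Type u} [Rack Q] (t : Term (Fin (n + 1))) (x : Q) (y : Fin n → Q) : Q :=
  t.eval (Fin.cons x y)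

/-- An equivalence relation is a congruence of the rack `Q` if it is invariant under both
operations `*` and `\`. -/
structure IsCongruence {Q : Type u} [Rack Q] (α : Setoid Q) : Prop where
  act : ∀ {a b c d : Q}, α a b → α c d → α (a ◃ c) (b ◃ d)
  invAct : ∀ {a b c d : Q}, α a b → α c d → α (a ◃⁻¹ c) (b ◃⁻¹ d)

/-- `α` is strongly abelian over `β`. -/
def IsStronglyAbelianOver {Q : Type u} [Rack Q] (α β : Setoid Q) : Prop :=
  ∀ (n : ℕ) (t : Term (Fin (n + 1))) (u v : Q) (a b c : Fin n → Q),
    α u v → (∀ i, α (a i) (b i)) → (∀ i, α (b i) (c i)) →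
    β (t.app u a) (t.app v b) → β (t.app u c) (t.app v c)

/-- The rack `Q` is strongly solvable of length at most `n`: there are congruences
`0 = α₀ ≤ α₁ ≤ … ≤ αₙ = 1` with `αᵢ₊₁` strongly abelian over `αᵢ`. -/
def IsStronglySolvableOfLengthAtMost (Q : Type u) [Rack Q] (n : ℕ) : Prop :=
  ∃ α : Fin (n + 1) → Setoid Q,
    (∀ i, IsCongruence (α i)) ∧ α 0 = ⊥ ∧ α (Fin.last n) = ⊤ ∧
    ∀ i : Fin n, α i.castSucc ≤ α i.succ ∧ IsStronglyAbelianOver (α i.succ) (α i.castSucc)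

/-- `α` centralizes `β` over `δ`, i.e. the term condition `C(α, β; δ)` of commutator theory. -/
def Centralizes {Q : Type u} [Rack Q] (α β δ : Setoid Q) : Prop :=
  ∀ (n : ℕ) (t : Term (Fin (n + 1))) (u v : Q) (a b : Fin n → Q),
    α u v → (∀ i, β (a i) (b i)) →
    δ (t.app u a) (t.app u b) → δ (t.app v a) (t.app v b)

/-- `α` is central over `δ`: the condition `C(α, 1; δ)`. For congruences `δ ≤ α` it says that the
congruence `α / δ` of `Q / δ` is central. -/
def IsCentralOver {Q : Type u} [Rack Q] (α δ : Setoid Q) : Prop :=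
  Centralizes α ⊤ δ

/-- The rack `Q` is nilpotent (in the sense of commutator theory) of length at most `n`: there are
congruences `0 = α₀ ≤ α₁ ≤ … ≤ αₙ = 1` with `αᵢ₊₁` central over `αᵢ`. -/
def IsNilpotentOfLengthAtMost (Q : Type u) [Rack Q] (n : ℕ) : Prop :=
  ∃ α : Fin (n + 1) → Setoid Q,
    (∀ i, IsCongruence (α i)) ∧ α 0 = ⊥ ∧ α (Fin.last n) = ⊤ ∧
    ∀ i : Fin n, α i.castSucc ≤ α i.succ ∧ IsCentralOver (α i.succ) (α i.castSucc)

end RackAlgebra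

/-!
Let `0 = α₀ ≤ α₁ ≤ … ≤ αₙ = 1` be a chain in which each `αᵢ₊₁` is strongly abelian over `αᵢ`, and
write `L x` for the left translation `y ↦ x ◃ y`. The strong term condition for the term `x ◃ y`
forces translations by `αᵢ₊₁`-related elements to agree modulo `αᵢ`
(`IsStronglyAbelianOver.act_left`).

For a congruence `β` let `K β` be the kernel of the action of the left multiplication group of `Q`
on `Q / β`. The orbits of `K β` form a congruence below `β`, and the central chain consists of the
orbit congruences of the `K αᵢ` for `i < n`, with the full relation on top (for `n = 0` the given
chain serves). The preceding remark says that `L x * (L y)⁻¹ ∈ K αᵢ` whenever `x` and `y` are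
`αᵢ₊₁`-related. Consequently, if `v = g u` with `g ∈ K αᵢ₊₁`, then modulo the orbits of `K αᵢ` the
value `t (v, a)` is either `t (u, a)` or `g (t (u, a))`, according to whether the rightmost
variable of `t` differs from `x` or equals it (`eval_cons_map`). Since `g` permutes the orbits of
`K αᵢ`, the centrality condition follows. For the top step all left translations agree modulo the
orbits of `K αₙ₋₁`, and a term operation depends only on its rightmost variable
(`isCentralOver_top_of_act_left`).
-/

namespace RackAlgebra

variable {Q : Type u} [Rack Q] {α β : Setoid Q}

/-! ### The left multiplication group -/

variable (Q) in
/-- The left multiplication group of a rack, generated by all left translations. -/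
def leftMulGroup : Subgroup (Equiv.Perm Q) :=
  Subgroup.closure (Set.range Rack.act')

lemma act'_mem_leftMulGroup (x : Q) : Rack.act' x ∈ leftMulGroup Q :=
  Subgroup.subset_closure ⟨x, rfl⟩

/-- Elements of the left multiplication group are automorphisms of the rack. -/
lemma map_act {g : Equiv.Perm Q} (hg : g ∈ leftMulGroup Q) (x y : Q) :
    g (x ◃ y) = g x ◃ g y := by
  induction hg using Subgroup.closure_induction generalizing x y with
  | mem g hg =>
    obtain ⟨z, rfl⟩ := hg
    exact Shelf.self_distrib
  | one => rfl
  | mul g h _ _ ihg ihh => rw [Equiv.Perm.mul_apply, ihh, ihg]; rfl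
  | inv g _ ih => rw [Equiv.Perm.inv_eq_iff_eq, ih]; simp

lemma map_invAct {g : Equiv.Perm Q} (hg : g ∈ leftMulGroup Q) (x y : Q) :
    g (x ◃⁻¹ y) = g x ◃⁻¹ g y := by
  rw [← Rack.left_cancel (g x), ← map_act hg, Rack.right_inv, Rack.right_inv]

/-- Elements of the left multiplication group permute the classes of every congruence. -/
lemma IsCongruence.map_iff (hβ : IsCongruence β) {g : Equiv.Perm Q} (hg : g ∈ leftMulGroup Q)
    {x y : Q} : β (g x) (g y) ↔ β x y := by
  induction hg using Subgroup.closure_induction generalizing x y with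
  | mem g hg =>
    obtain ⟨z, rfl⟩ := hg
    refine ⟨fun h => ?_, fun h => hβ.act (β.refl z) h⟩
    simpa using hβ.invAct (β.refl z) h
  | one => rfl
  | mul g h _ _ ihg ihh => exact ihg.trans ihh
  | inv g _ ih => rw [← ih]; simp

/-! ### Orbits of the kernel on a quotient -/

/-- The kernel of the action of the left multiplication group of `Q` on `Q / β`. -/
def leftMulKer (β : Setoid Q) : Subgroup (Equiv.Perm Q) where
  carrier := {h | h ∈ leftMulGroup Q ∧ ∀ x, β (h x) x}
  one_mem' := ⟨one_mem _, fun x => β.refl x⟩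
  mul_mem' := fun {g h} hg hh =>
    ⟨mul_mem hg.1 hh.1, fun x => β.trans (hg.2 (h x)) (hh.2 x)⟩
  inv_mem' := fun {g} hg =>
    ⟨inv_mem hg.1, fun x => by simpa using β.symm (hg.2 (g⁻¹ x))⟩

/-- The relation of lying in the same orbit of `leftMulKer β`. -/
def kerOrbit (β : Setoid Q) : Setoid Q := MulAction.orbitRel (leftMulKer β) Q

lemma kerOrbit_iff {x y : Q} : kerOrbit β x y ↔ ∃ h ∈ leftMulKer β, h y = x :=
  ⟨fun ⟨h, e⟩ => ⟨h, h.2, e⟩, fun ⟨h, hh, e⟩ => ⟨⟨h, hh⟩, e⟩⟩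

lemma kerOrbit_bot : kerOrbit (⊥ : Setoid Q) = ⊥ := by
  refine le_antisymm (fun x y hxy => ?_) bot_le
  obtain ⟨h, hh, rfl⟩ := kerOrbit_iff.1 hxy
  exact hh.2 y

lemma kerOrbit_mono (h : β ≤ α) : kerOrbit β ≤ kerOrbit α := fun x y hxy => by
  obtain ⟨g, hg, rfl⟩ := kerOrbit_iff.1 hxy
  exact kerOrbit_iff.2 ⟨g, ⟨hg.1, fun x => h (hg.2 x)⟩, rfl⟩

/-- The kernel is normal in the left multiplication group, which therefore permutes its orbits. -/
lemma kerOrbit_map (hβ : IsCongruence β) {g : Equiv.Perm Q} (hg : g ∈ leftMulGroup Q) {x y : Q}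
    (h : kerOrbit β x y) : kerOrbit β (g x) (g y) := by
  obtain ⟨k, hk, rfl⟩ := kerOrbit_iff.1 h
  refine kerOrbit_iff.2 ⟨g * k * g⁻¹, ⟨mul_mem (mul_mem hg hk.1) (inv_mem hg), fun z => ?_⟩, ?_⟩
  · simpa using (hβ.map_iff hg).2 (hk.2 (g⁻¹ z))
  · simp

/-- If left translations by `x` and `y` agree modulo `β`, then their quotient lies in
`leftMulKer β`. -/
lemma kerOrbit_act_left {x y : Q} (h : ∀ z, β (x ◃ z) (y ◃ z)) (z : Q) :
    kerOrbit β (x ◃ z) (y ◃ z) := by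
  refine kerOrbit_iff.2 ⟨Rack.act' x * (Rack.act' y)⁻¹,
    ⟨mul_mem (act'_mem_leftMulGroup x) (inv_mem (act'_mem_leftMulGroup y)), fun w => ?_⟩, ?_⟩
  · have := h (y ◃⁻¹ w)
    rwa [Rack.right_inv] at this
  · change x ◃ (y ◃⁻¹ (y ◃ z)) = x ◃ z
    rw [Rack.left_inv]

lemma IsCongruence.invAct_left (hβ : IsCongruence β) {x y : Q} (h : ∀ z, β (x ◃ z) (y ◃ z))
    (z : Q) : β (x ◃⁻¹ z) (y ◃⁻¹ z) := by
  have := hβ.invAct (β.refl x) (β.symm (h (y ◃⁻¹ z)))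
  rwa [Rack.right_inv, Rack.left_inv] at this

lemma IsCongruence.kerOrbit (hβ : IsCongruence β) : IsCongruence (kerOrbit β) := by
  have key {a b : Q} (hab : RackAlgebra.kerOrbit β a b) (z : Q) : β (a ◃ z) (b ◃ z) := by
    obtain ⟨h, hh, rfl⟩ := kerOrbit_iff.1 hab
    exact hβ.act (hh.2 b) (β.refl z)
  have act_right (a : Q) {c d : Q} (hcd : RackAlgebra.kerOrbit β c d) :
      RackAlgebra.kerOrbit β (a ◃ c) (a ◃ d) :=
    kerOrbit_map hβ (act'_mem_leftMulGroup a) hcd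
  have invAct_right (a : Q) {c d : Q} (hcd : RackAlgebra.kerOrbit β c d) :
      RackAlgebra.kerOrbit β (a ◃⁻¹ c) (a ◃⁻¹ d) :=
    kerOrbit_map hβ (inv_mem (act'_mem_leftMulGroup a)) hcd
  refine ⟨fun {a b c d} hab hcd => ?_, fun {a b c d} hab hcd => ?_⟩
  · exact Setoid.trans' _ (kerOrbit_act_left (key hab) c) (act_right b hcd)
  · -- Move `a ◃⁻¹ c` to `b ◃⁻¹ c` by translating the relation for `◃` back by `a`.
    have h := invAct_right a (Setoid.symm' _ (kerOrbit_act_left (key hab) (b ◃⁻¹ c)))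
    rw [Rack.right_inv, Rack.left_inv] at h
    exact Setoid.trans' _ h (invAct_right b hcd)

/-! ### Term conditions -/

lemma IsCongruence.eval (hβ : IsCongruence β) {ι : Type v} {f g : ι → Q} (h : ∀ i, β (f i) (g i))
    (t : Term ι) : β (t.eval f) (t.eval g) := by
  induction t with
  | var i => exact h i
  | act s t ihs iht => exact hβ.act ihs iht
  | invAct s t ihs iht => exact hβ.invAct ihs iht

lemma IsStronglyAbelianOver.act_left (h : IsStronglyAbelianOver α β) (hα : IsCongruence α)
    {x y : Q} (hxy : α x y) (z : Q) : β (x ◃ z) (y ◃ z) := by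
  have hb : α z (y ◃⁻¹ (x ◃ z)) := by
    have := hα.invAct (α.refl y) (hα.act (α.symm hxy) (α.refl z))
    rwa [Rack.left_inv] at this
  -- The premise of the term condition holds trivially: `x ◃ z = y ◃ (y ◃⁻¹ (x ◃ z))`.
  exact h 1 (.act (.var 0) (.var 1)) x y (fun _ => z) (fun _ => y ◃⁻¹ (x ◃ z)) (fun _ => z) hxy
    (fun _ => hb) (fun _ => α.symm hb) (by
      change β (x ◃ z) (y ◃ (y ◃⁻¹ (x ◃ z)))
      rw [Rack.right_inv])

/-- Moving the first variable `u` of a term by `g ∈ leftMulKer α` either does not affect the value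
modulo the orbits of `leftMulKer β`, or moves it by `g`, independently of the other variables. The
second case is that of terms whose rightmost variable is the first one. -/
lemma eval_cons_map (hα : IsCongruence α) (hβ : IsCongruence β)
    (hαβ : ∀ {x y : Q}, α x y → ∀ z, β (x ◃ z) (y ◃ z)) {g : Equiv.Perm Q}
    (hg : g ∈ leftMulKer α) (u : Q) {n : ℕ} (t : Term (Fin (n + 1))) :
    (∀ a, kerOrbit β (t.app (g u) a) (t.app u a)) ∨
      (∀ a, kerOrbit β (t.app (g u) a) (g (t.app u a))) := by
  have hδ := hβ.kerOrbit
  have hL {x y : Q} (h : α x y) : ∀ z, kerOrbit β (x ◃ z) (y ◃ z) := kerOrbit_act_left (hαβ h)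
  have happ (s : Term (Fin (n + 1))) (a : Fin n → Q) : α (s.app (g u) a) (s.app u a) :=
    hα.eval (Fin.cases (hg.2 u) fun i => α.refl (a i)) s
  have happ' (s : Term (Fin (n + 1))) (a : Fin n → Q) : α (s.app (g u) a) (g (s.app u a)) :=
    α.trans (happ s a) (α.symm (hg.2 _))
  induction t with
  | var i =>
    refine Fin.cases (Or.inr fun a => ?_) (fun j => Or.inl fun a => ?_) i
    · exact Setoid.refl' _ _
    · exact Setoid.refl' _ _
  | act s t _ iht =>
    refine iht.imp (fun iht a => ?_) (fun iht a => ?_)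
    · exact Setoid.trans' _ (hL (happ s a) _) (hδ.act (Setoid.refl' _ _) (iht a))
    · change kerOrbit β (s.app (g u) a ◃ t.app (g u) a) (g (s.app u a ◃ t.app u a))
      rw [map_act hg.1]
      exact Setoid.trans' _ (hL (happ' s a) _) (hδ.act (Setoid.refl' _ _) (iht a))
  | invAct s t _ iht =>
    refine iht.imp (fun iht a => ?_) (fun iht a => ?_)
    · exact Setoid.trans' _ (hδ.invAct_left (hL (happ s a)) _)
        (hδ.invAct (Setoid.refl' _ _) (iht a))
    · change kerOrbit β (s.app (g u) a ◃⁻¹ t.app (g u) a) (g (s.app u a ◃⁻¹ t.app u a))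
      rw [map_invAct hg.1]
      exact Setoid.trans' _ (hδ.invAct_left (hL (happ' s a)) _)
        (hδ.invAct (Setoid.refl' _ _) (iht a))

lemma isCentralOver_kerOrbit (hα : IsCongruence α) (hβ : IsCongruence β)
    (hαβ : ∀ {x y : Q}, α x y → ∀ z, β (x ◃ z) (y ◃ z)) :
    IsCentralOver (kerOrbit α) (kerOrbit β) := by
  intro n t u v a b huv _ hab
  obtain ⟨g, hg, rfl⟩ := kerOrbit_iff.1 (Setoid.symm' _ huv)
  rcases eval_cons_map hα hβ hαβ hg u t with h | h
  · exact Setoid.trans' _ (Setoid.trans' _ (h a) hab) (Setoid.symm' _ (h b))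
  · exact Setoid.trans' _ (Setoid.trans' _ (h a) (kerOrbit_map hβ hg.1 hab))
      (Setoid.symm' _ (h b))

/-- If all left translations agree modulo a congruence, then modulo it every term operation depends
on the rightmost variable only, so that the full relation is central over the congruence. -/
lemma isCentralOver_top_of_act_left (hβ : IsCongruence β) (h : ∀ x y z : Q, β (x ◃ z) (y ◃ z)) :
    IsCentralOver ⊤ β := by
  intro n t u v a b _ _ hab
  have key : (∀ c, β (t.app u c) (t.app v c)) ∨ (∀ w, β (t.app w a) (t.app w b)) := by
    clear hab
    induction t with
    | var i => exact Fin.cases (Or.inr fun w => β.refl w) (fun j => Or.inl fun c => β.refl _) i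
    | act s t _ iht =>
      exact iht.imp (fun iht c => β.trans (h _ _ _) (hβ.act (β.refl _) (iht c)))
        (fun iht w => β.trans (h _ _ _) (hβ.act (β.refl _) (iht w)))
    | invAct s t _ iht =>
      exact iht.imp
        (fun iht c => β.trans (hβ.invAct_left (h _ _) _) (hβ.invAct (β.refl _) (iht c)))
        (fun iht w => β.trans (hβ.invAct_left (h _ _) _) (hβ.invAct (β.refl _) (iht w)))
  rcases key with h | h
  · exact β.trans (β.symm (h a)) (β.trans hab (h b))
  · exact h v

end RackAlgebra

open RackAlgebra in
theorem mainTheorem5 {Q : Type*} [Rack Q] (n : ℕ)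
    (h : RackAlgebra.IsStronglySolvableOfLengthAtMost Q n) :
    RackAlgebra.IsNilpotentOfLengthAtMost Q n := by
  obtain ⟨α, hα, h0, hn, hs⟩ := h
  rcases n with _ | n
  · exact ⟨α, hα, h0, hn, fun i => i.elim0⟩
  -- The orbit congruence of `αₙ₊₁ = ⊤` may be smaller than `⊤`, so the top is set separately.
  refine ⟨Fin.snoc (fun i => kerOrbit (α i.castSucc)) ⊤, fun i => ?_, ?_, by simp, fun i => ?_⟩
  · induction i using Fin.lastCases with
    | last => simpa using ⟨fun _ _ => trivial, fun _ _ => trivial⟩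
    | cast i => simpa using (hα _).kerOrbit
  · rw [← Fin.castSucc_zero, Fin.snoc_castSucc, Fin.castSucc_zero, h0, kerOrbit_bot]
  · have key {x y : Q} (hxy : α i.succ x y) (z : Q) : α i.castSucc (x ◃ z) (y ◃ z) :=
      (hs i).2.act_left (hα _) hxy z
    rw [Fin.snoc_castSucc]
    induction i using Fin.lastCases with
    | last =>
      rw [Fin.succ_last, Fin.snoc_last]
      refine ⟨le_top, isCentralOver_top_of_act_left (hα _).kerOrbit fun x y =>
        kerOrbit_act_left (key ?_)⟩
      rw [Fin.succ_last, hn]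
      trivial
    | cast i =>
      rw [Fin.succ_castSucc, Fin.snoc_castSucc, ← Fin.succ_castSucc]
      exact ⟨kerOrbit_mono (hs i.castSucc).1, isCentralOver_kerOrbit (hα _) (hα _) key⟩
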